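/- Let $M=(\mathcal S,\mathcal A,P,R,\gamma,\rho)$ be an infinite-horizon discounted MDP with an arbitrary measurable state space $\mathcal S$, a finite action set $\mathcal A$, transition kernel $P$, reward distributions $R(s,a)$ on $[0,1]$ with mean $r(s,a)$, $\gamma\in[0,1)$ and initial distribution $\rho$. For a stationary policy $\pi$ let $d^\pi=(1-\gamma)\sum_{t\ge 0}\gamma^t\,\Pr((s_t,a_t)\in\cdot\,;\pi)$ be its discounted occupancy (with $s_0\sim\rho$), $V^\pi$ its value function, $J(\pi)=(1-\gamma)\mathbb E_{s\sim\rho}[V^\pi(s)]$, $f(s,\pi)=\sum_a\pi(a|s)f(s,a)$, $(\mathcal T^\pi f)(s,a)=r(s,a)+\gamma\,\mathbb E_{s'\sim P(\cdot|s,a)}[f(s',\pi)]$, and $\|g\|_{2,\nu}=\sqrt{\mathbb E_\nu[g^2]}$. Let $\mathcal F\subseteq\{f:\mathcal S\times\mathcal A\to[0,V_{\max}]\}$ with $V_{\max}\ge 1$, let $\mathcal W\subseteq\{w:\mathcal S\times\mathcal A\to[0,B_w]\}$ contain the constant function $1$, and let $\Pi$ be a class of stationary policies containing the uniform policy; all three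 classes are finite. Let $\mu=d^{\pi_b}$ be the occupancy of a behavior policy $\pi_b\in\Pi$, and let $\mathcal D=\{(s_i,a_i,r_i,s_i')\}_{i=1}^N$, $N\ge1$, be i.i.d. with $(s_i,a_i)\sim\mu$ and, given $(s_i,a_i)$, independently $r_i\sim R(s_i,a_i)$ and $s_i'\sim P(\cdot|s_i,a_i)$. Write $\mathbb E_{\mathcal D}$ for the average over $\mathcal D$, and put $$\mathcal L_{\mathcal D}(\pi,f)=\mathbb E_{\mathcal D}[f(s,\pi)-f(s,a)],\qquad \mathcal E_{\mathcal D}(\pi,f)=\max_{w\in\mathcal W}\bigl|\mathbb E_{\mathcal D}[w(s,a)(f(s,a)-r-\gamma f(s',\pi))]\bigr|.$$ The algorithm A-Crab with parameter $\beta$, number of rounds $K\ge1$ and a policy optimization oracle $\mathsf{PO}$ with values in $\Pi$ starts from the uniform policy $\pi_1$ and, for $k=1,\dots,K$, chooses $f_k\in\arg\min_{f\in\mathcal F}\{\mathcal L_{\mathcal D}(\pi_k,f)+\beta\,\mathcal E_{\mathcal D}(\pi_k,f)\}$ and sets $\pi_{k+1}=\mathsf{PO}(\pi_k,f_k,\mathcal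 D)$. Its output $\bar\pi$ is the uniform mixture of $\pi_1,\dots,\pi_K$ (an index is drawn once and the corresponding policy is followed), so that $J(\bar\pi)=\frac1K\sum_{k=1}^K J(\pi_k)$. Assume that: 1. $\epsilon_{\mathcal F}\ge0$ and, for every $\pi'\in\Pi$, $\min_{f\in\mathcal F}\max_{\pi''\in\Pi}\|f-\mathcal T^{\pi'}f\|_{2,d^{\pi''}}^2\le\epsilon_{\mathcal F}$; 2. $\|w\|_{2,\mu}\le C^\star_{\ell_2}$ for all $w\in\mathcal W$. Let $\pi\in\Pi$ be a comparator policy such that $d^\pi$ has a density $w^\pi=d^\pi/\mu$ with respect to $\mu$ which belongs to $\mathcal W$, and let $\delta\in(0,1)$. Then, with probability at least $1-\delta$ over $\mathcal D$, the output of A-Crab with $\beta=2$ satisfies $$J(\pi)-J(\bar\pi)\le c\left(\epsilon_{\mathrm{stat}}+C^\star_{\ell_2}\sqrt{\epsilon_{\mathcal F}}\right)+\epsilon^\pi_{\mathrm{opt}},$$ where $c>0$ is a universal constant, $$\epsilon_{\mathrm{stat}}=V_{\max}C^\star_{\ell_2}\sqrt{\frac{\log(|\mathcal F||\Pi||\mathcal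 W|/\delta)}{N}}+\frac{V_{\max}B_w\log(|\mathcal F||\Pi||\mathcal W|/\delta)}{N},$$ and $\epsilon^\pi_{\mathrm{opt}}=\frac1K\sum_{k=1}^K\mathbb E_{s\sim d^\pi}[f_k(s,\pi)-f_k(s,\pi_k)]$ is the average regret of the oracle against $\pi$. -/

import Mathlib

open MeasureTheory ProbabilityTheory

/-- A stationary stochastic policy `S → Δ(A)`: a Markov kernel from states to actions. -/
abbrev Policy (S A : Type*) [MeasurableSpace S] [MeasurableSpace A] :=
  {π : Kernel S A // IsMarkovKernel π}

instance Policy.instIsMarkovKernel {S A : Type*} [MeasurableSpace S] [MeasurableSpace A]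
    (π : Policy S A) : IsMarkovKernel π.1 := π.2

/-- An infinite-horizon discounted MDP with state space `S`, action space `A`, transition kernel
`P`, reward distributions `R` on `[0, 1]`, discount factor `γ ∈ [0, 1)` and initial law `ρ`. -/
structure MDP (S A : Type*) [MeasurableSpace S] [MeasurableSpace A] where
  P : Kernel (S × A) S
  markov_P : IsMarkovKernel P
  R : Kernel (S × A) ℝ
  markov_R : IsMarkovKernel R
  R_support : ∀ x, R x (Set.Icc (0 : ℝ) 1) = 1
  γ : ℝ
  γ_nonneg : 0 ≤ γ
  γ_lt_one : γ < 1
  ρ : Measure S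
  prob_ρ : IsProbabilityMeasure ρ

/-- One observation `((s, a), (r, s'))`. -/
abbrev Transition (S A : Type*) := (S × A) × (ℝ × S)

/-- A dataset of `N` observations. -/
abbrev Dataset (S A : Type*) (N : ℕ) := Fin N → Transition S A

noncomputable section

namespace Policy

variable {S A : Type*} [MeasurableSpace S] [MeasurableSpace A]

/-- `f(s, π) = ∑ₐ π(a | s) f(s, a)`. -/
def evalAt [Fintype A] (f : S × A → ℝ) (s : S) (π : Policy S A) : ℝ :=
  ∑ a, (π.1 s).real {a} * f (s, a)

/-- The policy that plays a uniformly random action in every state. -/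
def uniform (S A : Type*) [MeasurableSpace S] [MeasurableSpace A] [Fintype A] [Nonempty A] :
    Policy S A :=
  ⟨Kernel.const S (PMF.uniformOfFintype A).toMeasure, inferInstance⟩

end Policy

/-- The weighted norm `‖g‖_{2, ν} = √(E_ν[g²])`. -/
def l2Norm {X : Type*} [MeasurableSpace X] (ν : Measure X) (g : X → ℝ) : ℝ :=
  √(∫ x, g x ^ 2 ∂ν)

namespace MDP

variable {S A : Type*} [MeasurableSpace S] [MeasurableSpace A] (M : MDP S A)

instance instMarkovP : IsMarkovKernel M.P := M.markov_P

instance instMarkovR : IsMarkovKernel M.R := M.markov_R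

instance instProbρ : IsProbabilityMeasure M.ρ := M.prob_ρ

/-- The expected reward `r(s, a)`. -/
def r (x : S × A) : ℝ := ∫ y, y ∂(M.R x)

/-- The law of the state `s_t` when `s_0 ∼ ν` and actions are drawn from `π`. -/
def stateLaw (ν : Measure S) (π : Policy S A) : ℕ → Measure S
  | 0 => ν
  | t + 1 => ((stateLaw ν π t) ⊗ₘ π.1).bind M.P

/-- The law of the state-action pair `(s_t, a_t)` when `s_0 ∼ ν` and actions are drawn
from `π`. -/
def stateActionLaw (ν : Measure S) (π : Policy S A) (t : ℕ) : Measure (S × A) :=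
  (M.stateLaw ν π t) ⊗ₘ π.1

/-- The discounted occupancy `d^π = (1 - γ) ∑ₜ γᵗ P_t((s_t, a_t) ∈ · ; π)`, `s_0 ∼ ρ`. -/
def occupancy (π : Policy S A) : Measure (S × A) :=
  Measure.sum fun t : ℕ => ENNReal.ofReal ((1 - M.γ) * M.γ ^ t) • M.stateActionLaw M.ρ π t

/-- The value function `V^π(s)`: the expected discounted cumulative reward from `s_0 = s`. -/
def V (π : Policy S A) (s : S) : ℝ :=
  ∑' t : ℕ, M.γ ^ t * ∫ x, M.r x ∂(M.stateActionLaw (Measure.dirac s) π t)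

/-- The normalized average value `J(π) = (1 - γ) E_{s ∼ ρ}[V^π(s)]`. -/
def J (π : Policy S A) : ℝ := (1 - M.γ) * ∫ s, M.V π s ∂M.ρ

/-- The value of the mixture policy `Unif(π_0, …, π_{K-1})`: an index `k` is drawn uniformly
at random once, before the first step, and `π_k` is followed forever. -/
def JMixture (K : ℕ) (π : ℕ → Policy S A) : ℝ := (1 / (K : ℝ)) * ∑ k ∈ Finset.range K, M.J (π k)

/-- The Bellman operator `(T^π f)(s, a) = r(s, a) + γ E_{s' ∼ P(· | s, a)}[f(s', π)]`. -/
def bellman [Fintype A] (π : Policy S A) (f : S × A → ℝ) (x : S × A) : ℝ :=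
  M.r x + M.γ * ∫ s', Policy.evalAt f s' π ∂(M.P x)

/-- `w` is (a version of) the marginalized importance weight `d^π / μ`. -/
def IsImportanceWeight (μ : Measure (S × A)) (π : Policy S A) (w : S × A → ℝ) : Prop :=
  M.occupancy π = μ.withDensity fun x => ENNReal.ofReal (w x)

/-- The law of one observation: `(s, a) ∼ μ`, and given `(s, a)`, independently
`r ∼ R(s, a)` and `s' ∼ P(· | s, a)`. -/
def transitionLaw (μ : Measure (S × A)) : Measure (Transition S A) := μ ⊗ₘ (M.R ×ₖ M.P)

/-- The law of a dataset of `N` i.i.d. observations. -/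
def dataLaw (μ : Measure (S × A)) (N : ℕ) : Measure (Dataset S A N) :=
  Measure.pi fun _ => M.transitionLaw μ

/-- Approximate realizability with error `ε`: for each `π ∈ Pi`,
`min_{f ∈ F} max_{π' ∈ Pi} ‖f - T^π f‖²_{2, d^π'} ≤ ε`. -/
def ApproxRealizable [Fintype A] (F : Finset (S × A → ℝ)) (Pi : Finset (Policy S A))
    (ε : ℝ) : Prop :=
  ∀ π ∈ Pi, ∃ f ∈ F, ∀ π' ∈ Pi,
    l2Norm (M.occupancy π') (fun x => f x - M.bellman π f x) ^ 2 ≤ ε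

/-- The average regret `(1/K) ∑ₖ E_{s ∼ d^π}[f_k(s, π) - f_k(s, π_k)]` relative to `π` of the
policies `π_0, …, π_{K-1}` against the critics `f_0, …, f_{K-1}`. -/
def optError [Fintype A] (π : Policy S A) (K : ℕ) (πs : ℕ → Policy S A)
    (fs : ℕ → S × A → ℝ) : ℝ :=
  (1 / (K : ℝ)) * ∑ k ∈ Finset.range K,
    ∫ x, (Policy.evalAt (fs k) x.1 π - Policy.evalAt (fs k) x.1 (πs k)) ∂(M.occupancy π)

end MDP

namespace ACrab

variable {S A : Type*} [MeasurableSpace S] [MeasurableSpace A] [Fintype A] {N : ℕ}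

/-- The empirical actor objective `L_D(π, f)`. -/
def actorLoss (D : Dataset S A N) (π : Policy S A) (f : S × A → ℝ) : ℝ :=
  (1 / (N : ℝ)) * ∑ i, (Policy.evalAt f (D i).1.1 π - f (D i).1)

/-- The empirical importance-weighted average Bellman error
`E_D(π, f) = max_{w ∈ W} |E_D[w(s, a) (f(s, a) - r - γ f(s', π))]|`. -/
def bellmanError (γ : ℝ) (W : Finset (S × A → ℝ)) (D : Dataset S A N) (π : Policy S A)
    (f : S × A → ℝ) : ℝ :=
  ⨆ w : {w : S × A → ℝ // w ∈ W}, |(1 / (N : ℝ)) *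
    ∑ i, w.1 (D i).1 * (f (D i).1 - (D i).2.1 - γ * Policy.evalAt f (D i).2.2 π)|

/-- The critic's objective `L_D(π, f) + β E_D(π, f)`. -/
def criticObjective (γ β : ℝ) (W : Finset (S × A → ℝ)) (D : Dataset S A N) (π : Policy S A)
    (f : S × A → ℝ) : ℝ :=
  actorLoss D π f + β * bellmanError γ W D π f

/-- `π_0, …, π_{K-1}` and `f_0, …, f_{K-1}` are the iterates of a run of A-Crab for `K` rounds
with hyperparameter `β` and policy optimization oracle `PO` on the dataset `D`; ties in the
critic's minimization may be broken in any way. The output is the uniform mixture of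
`π_0, …, π_{K-1}`. -/
structure IsRun [Nonempty A] (γ β : ℝ) (F W : Finset (S × A → ℝ))
    (PO : Policy S A → (S × A → ℝ) → Dataset S A N → Policy S A) (K : ℕ) (D : Dataset S A N)
    (πs : ℕ → Policy S A) (fs : ℕ → S × A → ℝ) : Prop where
  init : πs 0 = Policy.uniform S A
  critic_mem : ∀ k < K, fs k ∈ F
  critic_min : ∀ k < K, ∀ f ∈ F,
    criticObjective γ β W D (πs k) (fs k) ≤ criticObjective γ β W D (πs k) f
  actor : ∀ k, k + 1 < K → πs (k + 1) = PO (πs k) (fs k) D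

end ACrab

/-- The statistical error
`V_max C √(log(|F||Pi||W|/δ) / N) + V_max B_w log(|F||Pi||W|/δ) / N`. -/
def epsStat (Vmax C Bw δ : ℝ) (cF cPi cW N : ℕ) : ℝ :=
  Vmax * C * √(Real.log ((cF : ℝ) * cPi * cW / δ) / N)
    + Vmax * Bw * Real.log ((cF : ℝ) * cPi * cW / δ) / N

end

/-!
The proof has a deterministic and a probabilistic half.

*Deterministic half.* For a critic `f` and a policy `p`, the number `(1 - γ) E_ρ[f(s, p)]` is the
critic's estimate of `J p`. The flow equation of the discounted occupancy
(`MDP.integral_fst_occupancy`) shows that it exceeds the value of *any* policy `q` by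
`E_{d^q}[f(s, p) - f(s, a)] + E_{d^q}[f - T^p f]` (`MDP.critic_value_sub_J`). In round `k` this
identity is used four times with `p = π_k`: for the selected critic `f_k` under the comparator and
under the behavior policy, and for the nearly realizable critic `f⋆` under the behavior policy and
under `π_k` itself. Summing, `J π - J π_k` becomes the regret against `π`, plus
`L_μ(π_k, f_k) - L_μ(π_k, f⋆)`, plus the Bellman residuals of `f_k` weighted by `w^π` and by `1`,
plus residuals of `f⋆`. Both weights lie in the weight class, so the residuals of `f_k` cost at
most twice the weighted Bellman error: this is the reason for `β = 2`, as the minimality of `f_k`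
then replaces `f_k` by `f⋆`. The residuals of `f⋆` are at most `C √ε_F` by Cauchy-Schwarz, and
`1 ≤ C` because the constant weight `1` is in the class (`MDP.J_sub_J_le_of_critic_min`).

*Probabilistic half.* The empirical losses are averages of i.i.d. terms bounded by `2 V_max B_w`
with second moment at most `4 V_max² C²`. A Chernoff bound based on `exp x ≤ 1 + x + x²` for
`|x| ≤ 1` gives Bernstein's inequality (`MeasureTheory.measure_abs_deviation_le_exp`), and a union
bound makes all losses accurate at once (`MDP.measure_not_uniformlyAccurate_le`). The union bound
has a constant factor `4` inside the logarithm. It is absorbed into the universal constant when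
there are at least two policies; with a single policy the algorithm always returns the comparator.
-/

/-! ### Integrals of bounded functions -/

namespace MeasureTheory

variable {X Y : Type*} [MeasurableSpace X] [MeasurableSpace Y]

theorem integrable_of_abs_le {μ : Measure X} [IsFiniteMeasure μ] {g : X → ℝ} {C : ℝ}
    (hg : Measurable g) (hC : ∀ x, |g x| ≤ C) : Integrable g μ :=
  Integrable.of_bound hg.aestronglyMeasurable C (ae_of_all _ hC)

theorem abs_integral_le_of_abs_le {μ : Measure X} [IsProbabilityMeasure μ] {g : X → ℝ} {C : ℝ}
    (hC : ∀ x, |g x| ≤ C) : |∫ x, g x ∂μ| ≤ C := by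
  simpa using norm_integral_le_of_norm_le_const (μ := μ) (f := g) (C := C) (ae_of_all _ hC)

theorem measurable_integral_kernel {κ : Kernel X Y} {g : Y → ℝ} (hg : Measurable g) :
    Measurable fun x => ∫ y, g y ∂(κ x) :=
  hg.stronglyMeasurable.integral_kernel.measurable

theorem integral_measure_comp {μ : Measure X} [IsProbabilityMeasure μ] {κ : Kernel X Y}
    [IsMarkovKernel κ] {g : Y → ℝ} {C : ℝ} (hg : Measurable g) (hC : ∀ y, |g y| ≤ C) :
    ∫ y, g y ∂(κ ∘ₘ μ) = ∫ x, ∫ y, g y ∂(κ x) ∂μ := by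
  have h : Integrable g (κ ∘ₘ μ) := integrable_of_abs_le hg hC
  rw [Measure.comp_eq_comp_const_apply] at h ⊢
  simpa using Kernel.integral_comp h

/-- The Cauchy-Schwarz inequality. -/
theorem abs_integral_mul_le_l2Norm {μ : Measure X} [IsProbabilityMeasure μ] {u v : X → ℝ}
    {C D : ℝ} (hu : Measurable u) (hv : Measurable v) (hC : ∀ x, |u x| ≤ C)
    (hD : ∀ x, |v x| ≤ D) :
    |∫ x, u x * v x ∂μ| ≤ l2Norm μ u * l2Norm μ v := by
  have hpq : Real.HolderConjugate 2 2 := Real.HolderConjugate.two_two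
  have h := integral_mul_norm_le_Lp_mul_Lq (μ := μ) (f := u) (g := v) hpq
    (MemLp.of_bound hu.aestronglyMeasurable C (ae_of_all _ hC))
    (MemLp.of_bound hv.aestronglyMeasurable D (ae_of_all _ hD))
  calc |∫ x, u x * v x ∂μ| ≤ ∫ x, ‖u x * v x‖ ∂μ :=
        norm_integral_le_integral_norm fun x => u x * v x
    _ = ∫ x, ‖u x‖ * ‖v x‖ ∂μ := by simp only [norm_mul]
    _ ≤ _ := h
    _ = _ := by
      simp only [l2Norm, Real.sqrt_eq_rpow, Real.rpow_two, Real.norm_eq_abs, sq_abs]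

end MeasureTheory

/-! ### Policies -/

namespace Policy

variable {S A : Type*} [MeasurableSpace S] [MeasurableSpace A] [MeasurableSingletonClass A]
  [Fintype A] {f : S × A → ℝ} {C : ℝ}

theorem sum_real_singleton (π : Policy S A) (s : S) : ∑ a, (π.1 s).real {a} = 1 := by
  simp

theorem measurable_evalAt (hf : Measurable f) (π : Policy S A) :
    Measurable fun s => evalAt f s π := by
  unfold evalAt
  refine Finset.measurable_sum _ fun a _ => ?_
  exact ((Kernel.measurable_coe π.1 (MeasurableSet.singleton a)).ennreal_toReal).mul
    (hf.comp (by fun_prop))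

theorem evalAt_mem_Icc (hf : ∀ x, f x ∈ Set.Icc 0 C) (π : Policy S A) (s : S) :
    evalAt f s π ∈ Set.Icc 0 C := by
  refine ⟨Finset.sum_nonneg fun a _ => mul_nonneg measureReal_nonneg (hf _).1, ?_⟩
  calc evalAt f s π ≤ ∑ a, (π.1 s).real {a} * C :=
        Finset.sum_le_sum fun a _ => mul_le_mul_of_nonneg_left (hf _).2 measureReal_nonneg
    _ = C := by rw [← Finset.sum_mul, sum_real_singleton, one_mul]

theorem integral_eq_evalAt (f : S × A → ℝ) (π : Policy S A) (s : S) :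
    ∫ a, f (s, a) ∂(π.1 s) = evalAt f s π := by
  rw [integral_fintype .of_finite]
  rfl

end Policy

/-! ### Occupancies and the performance difference identity -/

namespace MDP

variable {S A : Type*} [MeasurableSpace S] [MeasurableSpace A] (M : MDP S A)

theorem one_sub_γ_pos : 0 < 1 - M.γ := sub_pos.2 M.γ_lt_one

theorem ae_mem_Icc_reward (x : S × A) : ∀ᵐ y ∂(M.R x), y ∈ Set.Icc (0 : ℝ) 1 :=
  mem_ae_iff_prob_eq_one measurableSet_Icc |>.2 (M.R_support x)

theorem integrable_reward (x : S × A) : Integrable (fun y : ℝ => y) (M.R x) := by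
  refine Integrable.of_bound (by fun_prop) 1 ?_
  filter_upwards [M.ae_mem_Icc_reward x] with y hy
  rw [Real.norm_eq_abs, abs_of_nonneg hy.1]
  exact hy.2

theorem measurable_r : Measurable M.r := measurable_integral_kernel measurable_id

theorem r_mem_Icc (x : S × A) : M.r x ∈ Set.Icc (0 : ℝ) 1 := by
  refine ⟨integral_nonneg_of_ae ?_, ?_⟩
  · filter_upwards [M.ae_mem_Icc_reward x] with y hy using hy.1
  · have h := integral_mono_ae (M.integrable_reward x) (integrable_const (1 : ℝ))
      (by filter_upwards [M.ae_mem_Icc_reward x] with y hy using hy.2)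
    simpa [r] using h

theorem abs_r_le (x : S × A) : |M.r x| ≤ 1 := by
  rw [abs_of_nonneg (M.r_mem_Icc x).1]
  exact (M.r_mem_Icc x).2

instance isProbabilityMeasure_stateLaw (ν : Measure S) [IsProbabilityMeasure ν]
    (π : Policy S A) (t : ℕ) : IsProbabilityMeasure (M.stateLaw ν π t) := by
  induction t with
  | zero => assumption
  | succ t ih =>
    rw [stateLaw]
    infer_instance

instance isProbabilityMeasure_stateActionLaw (ν : Measure S) [IsProbabilityMeasure ν]
    (π : Policy S A) (t : ℕ) : IsProbabilityMeasure (M.stateActionLaw ν π t) := by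
  rw [stateActionLaw]
  infer_instance

theorem exists_kernel_stateLaw (π : Policy S A) (t : ℕ) :
    ∃ κ : Kernel S S, IsMarkovKernel κ ∧
      ∀ (ν : Measure S) [IsProbabilityMeasure ν], M.stateLaw ν π t = κ ∘ₘ ν := by
  induction t with
  | zero => exact ⟨Kernel.id, inferInstance, fun ν _ => by rw [Measure.id_comp, stateLaw]⟩
  | succ t ih =>
    obtain ⟨κ, hκ, h⟩ := ih
    refine ⟨M.P ∘ₖ ((Kernel.id ×ₖ π.1) ∘ₖ κ), inferInstance, fun ν _ => ?_⟩
    rw [stateLaw, Measure.compProd_eq_comp_prod, h, Measure.comp_assoc, Measure.comp_assoc,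
      Kernel.comp_assoc]

/-- The law of `(s_t, a_t)` depends on the initial law through a Markov kernel. This provides the
measurability in the initial state that lets the value function be integrated. -/
theorem exists_kernel_stateActionLaw (π : Policy S A) (t : ℕ) :
    ∃ κ : Kernel S (S × A), IsMarkovKernel κ ∧
      ∀ (ν : Measure S) [IsProbabilityMeasure ν], M.stateActionLaw ν π t = κ ∘ₘ ν := by
  obtain ⟨κ, hκ, h⟩ := M.exists_kernel_stateLaw π t
  refine ⟨(Kernel.id ×ₖ π.1) ∘ₖ κ, inferInstance, fun ν _ => ?_⟩
  rw [stateActionLaw, Measure.compProd_eq_comp_prod, h, Measure.comp_assoc]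

theorem summable_discount : Summable fun t : ℕ => (1 - M.γ) * M.γ ^ t :=
  (summable_geometric_of_lt_one M.γ_nonneg M.γ_lt_one).mul_left _

theorem discount_nonneg (t : ℕ) : 0 ≤ (1 - M.γ) * M.γ ^ t :=
  mul_nonneg M.one_sub_γ_pos.le (pow_nonneg M.γ_nonneg t)

theorem tsum_discount : ∑' t : ℕ, (1 - M.γ) * M.γ ^ t = 1 := by
  rw [tsum_mul_left, tsum_geometric_of_lt_one M.γ_nonneg M.γ_lt_one,
    mul_inv_cancel₀ M.one_sub_γ_pos.ne']

instance isProbabilityMeasure_occupancy (π : Policy S A) :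
    IsProbabilityMeasure (M.occupancy π) := by
  constructor
  rw [occupancy, Measure.sum_apply _ MeasurableSet.univ]
  simp only [Measure.smul_apply, measure_univ, smul_eq_mul, mul_one]
  rw [← ENNReal.ofReal_tsum_of_nonneg M.discount_nonneg M.summable_discount, M.tsum_discount,
    ENNReal.ofReal_one]

theorem hasSum_integral_occupancy (π : Policy S A) {g : S × A → ℝ} {C : ℝ} (hg : Measurable g)
    (hC : ∀ x, |g x| ≤ C) :
    HasSum (fun t : ℕ => (1 - M.γ) * M.γ ^ t * ∫ x, g x ∂(M.stateActionLaw M.ρ π t))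
      (∫ x, g x ∂(M.occupancy π)) := by
  have h : Integrable g (M.occupancy π) := integrable_of_abs_le hg hC
  have h' := hasSum_integral_measure h
  simp only [integral_smul_measure, ENNReal.toReal_ofReal (M.discount_nonneg _),
    smul_eq_mul] at h'
  exact h'

/-- The normalized value is the mean reward under the occupancy. -/
theorem J_eq_integral_r (π : Policy S A) : M.J π = ∫ x, M.r x ∂(M.occupancy π) := by
  rw [← (M.hasSum_integral_occupancy π M.measurable_r M.abs_r_le).tsum_eq]
  choose κ hκ h using M.exists_kernel_stateActionLaw π
  have hV (s : S) : M.V π s = ∑' t : ℕ, M.γ ^ t * ∫ x, M.r x ∂(κ t s) := by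
    simp only [V, h _ (Measure.dirac s), Measure.dirac_bind (κ _).measurable]
  have hm (t : ℕ) : Measurable fun s => M.γ ^ t * ∫ x, M.r x ∂(κ t s) :=
    (measurable_integral_kernel M.measurable_r).const_mul _
  have hb (t : ℕ) (s : S) : |M.γ ^ t * ∫ x, M.r x ∂(κ t s)| ≤ M.γ ^ t := by
    rw [abs_mul, abs_of_nonneg (pow_nonneg M.γ_nonneg t)]
    exact mul_le_of_le_one_right (pow_nonneg M.γ_nonneg t)
      (abs_integral_le_of_abs_le M.abs_r_le)
  have hs : Summable fun t : ℕ => ∫ s, ‖M.γ ^ t * ∫ x, M.r x ∂(κ t s)‖ ∂M.ρ := by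
    refine Summable.of_nonneg_of_le (fun t => integral_nonneg fun s => norm_nonneg _) (fun t => ?_)
      (summable_geometric_of_lt_one M.γ_nonneg M.γ_lt_one)
    refine (le_abs_self _).trans (abs_integral_le_of_abs_le fun s => ?_)
    rw [abs_norm]
    exact hb t s
  rw [J]
  simp only [hV]
  rw [← integral_tsum_of_summable_integral_norm
    (fun t => integrable_of_abs_le (hm t) (hb t)) hs, ← tsum_mul_left]
  refine tsum_congr fun t => ?_
  rw [h t, integral_measure_comp M.measurable_r M.abs_r_le, integral_const_mul, mul_assoc]

/-- The flow equation of the discounted occupancy, tested against a function of the state. -/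
theorem integral_fst_occupancy (π : Policy S A) {g : S → ℝ} {C : ℝ} (hg : Measurable g)
    (hC : ∀ s, |g s| ≤ C) :
    ∫ x, g x.1 ∂(M.occupancy π) =
      (1 - M.γ) * ∫ s, g s ∂M.ρ + M.γ * ∫ x, ∫ s', g s' ∂(M.P x) ∂(M.occupancy π) := by
  have hfst (t : ℕ) : ∫ x, g x.1 ∂(M.stateActionLaw M.ρ π t) = ∫ s, g s ∂(M.stateLaw M.ρ π t) := by
    rw [stateActionLaw, Measure.integral_compProd
      (integrable_of_abs_le (hg.fun_comp measurable_fst) fun x => hC x.1)]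
    simp
  have hsucc (t : ℕ) : ∫ s, g s ∂(M.stateLaw M.ρ π (t + 1)) =
      ∫ x, ∫ s', g s' ∂(M.P x) ∂(M.stateActionLaw M.ρ π t) :=
    integral_measure_comp (μ := M.stateActionLaw M.ρ π t) hg hC
  have h1 := M.hasSum_integral_occupancy π (hg.fun_comp measurable_fst) fun x => hC x.1
  have h2 := (M.hasSum_integral_occupancy π (measurable_integral_kernel (κ := M.P) hg)
    fun x => abs_integral_le_of_abs_le hC).mul_left M.γ
  simp only [hfst] at h1
  rw [← h1.tsum_eq, h1.summable.tsum_eq_zero_add, ← h2.tsum_eq]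
  congr 1
  · simp [stateLaw]
  · refine tsum_congr fun t => ?_
    rw [hsucc]
    ring

variable [MeasurableSingletonClass A] [Fintype A] {f : S × A → ℝ} {C : ℝ}

theorem integral_evalAt_occupancy (hf : Measurable f) (hC : ∀ x, f x ∈ Set.Icc 0 C)
    (π : Policy S A) :
    ∫ x, Policy.evalAt f x.1 π ∂(M.occupancy π) = ∫ x, f x ∂(M.occupancy π) := by
  have hfC (x : S × A) : |f x| ≤ C := by rw [abs_of_nonneg (hC x).1]; exact (hC x).2
  have heC (s : S) : |Policy.evalAt f s π| ≤ C := by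
    have := Policy.evalAt_mem_Icc hC π s
    rw [abs_of_nonneg this.1]; exact this.2
  have hm := Policy.measurable_evalAt hf π
  rw [← (M.hasSum_integral_occupancy π hf hfC).tsum_eq,
    ← (M.hasSum_integral_occupancy π (hm.fun_comp measurable_fst) fun x => heC x.1).tsum_eq]
  refine tsum_congr fun t => ?_
  congr 1
  rw [stateActionLaw, Measure.integral_compProd (integrable_of_abs_le hf hfC),
    Measure.integral_compProd (integrable_of_abs_le (hm.fun_comp measurable_fst) fun x => heC x.1)]
  simp [Policy.integral_eq_evalAt]

theorem measurable_bellman (hf : Measurable f) (π : Policy S A) : Measurable (M.bellman π f) :=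
  M.measurable_r.add ((measurable_integral_kernel (Policy.measurable_evalAt hf π)).const_mul _)

theorem abs_sub_bellman_le (hC : ∀ x, f x ∈ Set.Icc 0 C) (π : Policy S A) (x : S × A) :
    |f x - M.bellman π f x| ≤ 1 + C := by
  have hC0 : 0 ≤ C := (hC x).1.trans (hC x).2
  have hI0 : 0 ≤ ∫ s', Policy.evalAt f s' π ∂(M.P x) :=
    integral_nonneg fun s => (Policy.evalAt_mem_Icc hC π s).1
  have hI : ∫ s', Policy.evalAt f s' π ∂(M.P x) ≤ C :=
    (le_abs_self _).trans <| abs_integral_le_of_abs_le fun s => by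
      rw [abs_of_nonneg (Policy.evalAt_mem_Icc hC π s).1]
      exact (Policy.evalAt_mem_Icc hC π s).2
  have hγI : M.γ * ∫ s', Policy.evalAt f s' π ∂(M.P x) ≤ C :=
    (mul_le_of_le_one_left hI0 M.γ_lt_one.le).trans hI
  have hγI0 := mul_nonneg M.γ_nonneg hI0
  have := hC x
  have := M.r_mem_Icc x
  simp only [Set.mem_Icc, bellman] at *
  rw [abs_le]
  constructor <;> linarith

/-- The performance difference identity: the critic's estimate `(1 - γ) E_ρ[f(s, π)]` of `J π`
exceeds the value of any other policy `π'` by its actor loss plus its mean Bellman residual, both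
taken under the occupancy of `π'`. -/
theorem critic_value_sub_J (hf : Measurable f) (hC : ∀ x, f x ∈ Set.Icc 0 C)
    (π π' : Policy S A) :
    (1 - M.γ) * ∫ s, Policy.evalAt f s π ∂M.ρ - M.J π' =
      ∫ x, (Policy.evalAt f x.1 π - f x) ∂(M.occupancy π') +
        ∫ x, (f x - M.bellman π f x) ∂(M.occupancy π') := by
  have hfC (x : S × A) : |f x| ≤ C := by rw [abs_of_nonneg (hC x).1]; exact (hC x).2
  have heC (s : S) : |Policy.evalAt f s π| ≤ C := by
    have := Policy.evalAt_mem_Icc hC π s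
    rw [abs_of_nonneg this.1]; exact this.2
  have hm := Policy.measurable_evalAt hf π
  have hi1 : Integrable f (M.occupancy π') := integrable_of_abs_le hf hfC
  have hi2 : Integrable (fun x => Policy.evalAt f x.1 π) (M.occupancy π') :=
    integrable_of_abs_le (hm.fun_comp measurable_fst) fun x => heC x.1
  have hi3 : Integrable (fun x => ∫ s', Policy.evalAt f s' π ∂(M.P x)) (M.occupancy π') :=
    integrable_of_abs_le (measurable_integral_kernel hm) fun x => abs_integral_le_of_abs_le heC
  have hi4 : Integrable M.r (M.occupancy π') := integrable_of_abs_le M.measurable_r M.abs_r_le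
  have hflow := M.integral_fst_occupancy π' hm heC
  have hb : ∫ x, M.bellman π f x ∂(M.occupancy π') = M.J π' +
      M.γ * ∫ x, ∫ s', Policy.evalAt f s' π ∂(M.P x) ∂(M.occupancy π') := by
    simp only [bellman]
    rw [integral_add hi4 (hi3.const_mul _), integral_const_mul, J_eq_integral_r]
  have hi5 : Integrable (M.bellman π f) (M.occupancy π') := hi4.add (hi3.const_mul _)
  rw [integral_sub hi2 hi1, integral_sub hi1 hi5, hb, hflow]
  ring

end MDP

/-! ### Bernstein's inequality for averages -/

noncomputable section

/-- The average of `h` over the sample `D`. -/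
def empiricalMean {X : Type*} {N : ℕ} (D : Fin N → X) (h : X → ℝ) : ℝ :=
  (1 / (N : ℝ)) * ∑ i, h (D i)

/-- Bernstein's deviation `2 √(v L / N) + b L / N` for an average of `N` terms bounded by `b`
with second moment at most `v`, at confidence level `exp (-L)`. -/
def bernsteinDeviation (b v L : ℝ) (N : ℕ) : ℝ := 2 * √(v * L / N) + b * L / N

namespace MeasureTheory

variable {X : Type*} [MeasurableSpace X] {μ : Measure X} [IsProbabilityMeasure μ] {h : X → ℝ}
  {b v L : ℝ} {N : ℕ}

/-- The moment generating function bound obtained by integrating `exp y ≤ 1 + y + y²`, valid for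
`|y| ≤ 1`, at `y = t h`. -/
theorem integral_exp_mul_le (hm : Measurable h) (hb : ∀ᵐ x ∂μ, |h x| ≤ b)
    (hv : ∫ x, h x ^ 2 ∂μ ≤ v) {t : ℝ} (ht : 0 ≤ t) (htb : t * b ≤ 1) :
    ∫ x, Real.exp (t * h x) ∂μ ≤ Real.exp (t * ∫ x, h x ∂μ + t ^ 2 * v) := by
  have hi : Integrable h μ := Integrable.of_bound hm.aestronglyMeasurable b hb
  have hi2 : Integrable (fun x => h x ^ 2) μ := by
    refine Integrable.of_bound (hm.pow_const 2).aestronglyMeasurable (b ^ 2) ?_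
    filter_upwards [hb] with x hx
    rw [Real.norm_eq_abs, abs_pow]
    exact pow_le_pow_left₀ (abs_nonneg _) hx 2
  have hle : ∀ᵐ x ∂μ, Real.exp (t * h x) ≤ 1 + t * h x + t ^ 2 * h x ^ 2 := by
    filter_upwards [hb] with x hx
    have h1 : |t * h x| ≤ 1 := by
      rw [abs_mul, abs_of_nonneg ht]
      exact (mul_le_mul_of_nonneg_left hx ht).trans htb
    have := (abs_le.1 (Real.abs_exp_sub_one_sub_id_le h1)).2
    nlinarith
  have hi1 : Integrable (fun x => 1 + t * h x) μ := (integrable_const _).add (hi.const_mul _)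
  calc ∫ x, Real.exp (t * h x) ∂μ ≤ ∫ x, (1 + t * h x + t ^ 2 * h x ^ 2) ∂μ :=
        integral_mono_of_nonneg (ae_of_all _ fun x => (Real.exp_pos _).le)
          (hi1.add (hi2.const_mul _)) hle
    _ = 1 + t * ∫ x, h x ∂μ + t ^ 2 * ∫ x, h x ^ 2 ∂μ := by
        rw [integral_add hi1 (hi2.const_mul _),
          integral_add (integrable_const _) (hi.const_mul _), integral_const_mul,
          integral_const_mul]
        simp
    _ ≤ (t * ∫ x, h x ∂μ + t ^ 2 * v) + 1 := by
        have := mul_le_mul_of_nonneg_left hv (sq_nonneg t)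
        linarith
    _ ≤ _ := Real.add_one_le_exp _

/-- The choice of the Chernoff parameter: `t = min (1 / b) √(L / (N v))`. -/
theorem exists_chernoff_parameter (hb : 0 < b) (hv : 0 < v) (hL : 0 ≤ L) (hN : 0 < N) :
    ∃ t : ℝ, 0 ≤ t ∧ t * b ≤ 1 ∧ L ≤ N * (t * bernsteinDeviation b v L N - t ^ 2 * v) := by
  have hN' : (0 : ℝ) < N := Nat.cast_pos.2 hN
  obtain ⟨s, hs⟩ : ∃ s, s = √(L / (N * v)) := ⟨_, rfl⟩
  have hs0 : 0 ≤ s := hs ▸ Real.sqrt_nonneg _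
  have hs2 : s ^ 2 = L / (N * v) := hs ▸ Real.sq_sqrt (by positivity)
  have hL' : L = N * v * s ^ 2 := by rw [hs2]; field_simp
  have hdev : bernsteinDeviation b v L N = 2 * (v * s) + b * L / N := by
    rw [bernsteinDeviation]
    congr 2
    rw [hL', show v * (N * v * s ^ 2) / N = (v * s) ^ 2 by field_simp]
    exact Real.sqrt_sq (by positivity)
  rw [hdev]
  by_cases hsb : s * b ≤ 1
  · refine ⟨s, hs0, hsb, ?_⟩
    have h2 : 0 ≤ s * (b * L) := by positivity
    have : (N : ℝ) * (s * (2 * (v * s) + b * L / N) - s ^ 2 * v) = N * v * s ^ 2 + s * (b * L) := by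
      field_simp
      ring
    linarith
  · refine ⟨1 / b, by positivity, by field_simp; exact le_rfl, ?_⟩
    push Not at hsb
    have : (N : ℝ) * (1 / b * (2 * (v * s) + b * L / N) - (1 / b) ^ 2 * v) =
        L + N * v * (2 * (s * b) - 1) / b ^ 2 := by
      field_simp
      ring
    have h2 : 0 ≤ N * v * (2 * (s * b) - 1) / b ^ 2 := by
      have : 0 ≤ 2 * (s * b) - 1 := by linarith
      positivity
    linarith

theorem measure_deviation_le_exp (hm : Measurable h) (hb : ∀ᵐ x ∂μ, |h x| ≤ b)
    (hv : ∫ x, h x ^ 2 ∂μ ≤ v) (hb0 : 0 < b) (hv0 : 0 < v) (hL : 0 ≤ L) (hN : 0 < N) :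
    Measure.pi (fun _ : Fin N => μ)
      {D | bernsteinDeviation b v L N < empiricalMean D h - ∫ x, h x ∂μ} ≤
        ENNReal.ofReal (Real.exp (-L)) := by
  have hN' : (0 : ℝ) < N := Nat.cast_pos.2 hN
  obtain ⟨t, ht0, htb, ht⟩ := exists_chernoff_parameter hb0 hv0 hL hN
  set P := Measure.pi (fun _ : Fin N => μ)
  set m := ∫ x, h x ∂μ
  set e := bernsteinDeviation b v L N
  have hexp (D : Fin N → X) : Real.exp (t * ∑ i, h (D i)) = ∏ i, Real.exp (t * h (D i)) := by
    rw [Finset.mul_sum, Real.exp_sum]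
  have hint : Integrable (fun x => Real.exp (t * h x)) μ := by
    refine Integrable.of_bound (by fun_prop) (Real.exp (t * b)) ?_
    filter_upwards [hb] with x hx
    rw [Real.norm_eq_abs, Real.abs_exp, Real.exp_le_exp]
    exact mul_le_mul_of_nonneg_left ((le_abs_self _).trans hx) ht0
  have hintP : Integrable (fun D : Fin N → X => Real.exp (t * ∑ i, h (D i))) P := by
    simp only [hexp]
    exact Integrable.fintype_prod fun _ => hint
  have hmgf : mgf (fun D : Fin N → X => ∑ i, h (D i)) P t ≤
      Real.exp (t * m + t ^ 2 * v) ^ N := by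
    rw [mgf]
    simp only [hexp]
    rw [integral_fintype_prod_eq_pow (ι := Fin N) (fun x => Real.exp (t * h x)), Fintype.card_fin]
    exact pow_le_pow_left₀ (integral_nonneg fun x => (Real.exp_pos _).le)
      (integral_exp_mul_le hm hb hv ht0 htb) N
  have hch := measure_ge_le_exp_mul_mgf (N * (m + e)) ht0 hintP
  calc P {D | e < empiricalMean D h - m}
      ≤ P {D | N * (m + e) ≤ ∑ i, h (D i)} := by
        refine measure_mono fun D hD => ?_
        simp only [Set.mem_ofPred_eq, empiricalMean] at hD ⊢
        have h1 : m + e ≤ 1 / N * ∑ i, h (D i) := by linarith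
        have h2 := mul_le_mul_of_nonneg_left h1 hN'.le
        rwa [← mul_assoc, mul_one_div_cancel hN'.ne', one_mul] at h2
    _ = ENNReal.ofReal (P.real {D | N * (m + e) ≤ ∑ i, h (D i)}) := by
        rw [measureReal_def, ENNReal.ofReal_toReal (measure_ne_top _ _)]
    _ ≤ ENNReal.ofReal (Real.exp (-L)) := by
        refine ENNReal.ofReal_le_ofReal (hch.trans ?_)
        calc Real.exp (-t * (N * (m + e))) * mgf (fun D : Fin N → X => ∑ i, h (D i)) P t
            ≤ Real.exp (-t * (N * (m + e))) * Real.exp (t * m + t ^ 2 * v) ^ N :=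
              mul_le_mul_of_nonneg_left hmgf (Real.exp_pos _).le
          _ = Real.exp (-(N * (t * e - t ^ 2 * v))) := by
              rw [← Real.exp_nat_mul, ← Real.exp_add]
              congr 1
              ring
          _ ≤ Real.exp (-L) := Real.exp_le_exp.2 (neg_le_neg ht)

/-- Bernstein's inequality for the average of an i.i.d. sample, with the second moment in place of
the variance. -/
theorem measure_abs_deviation_le_exp (hm : Measurable h) (hb : ∀ᵐ x ∂μ, |h x| ≤ b)
    (hv : ∫ x, h x ^ 2 ∂μ ≤ v) (hb0 : 0 < b) (hv0 : 0 < v) (hL : 0 ≤ L) (hN : 0 < N) :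
    Measure.pi (fun _ : Fin N => μ)
      {D | bernsteinDeviation b v L N < |empiricalMean D h - ∫ x, h x ∂μ|} ≤
        ENNReal.ofReal (2 * Real.exp (-L)) := by
  have h1 := measure_deviation_le_exp hm hb hv hb0 hv0 hL hN
  have h2 := measure_deviation_le_exp (h := fun x => -h x) hm.neg (by simpa using hb)
    (by simpa using hv) hb0 hv0 hL hN
  refine (measure_mono fun D hD => ?_).trans ((measure_union_le _ _).trans
    ((add_le_add h1 h2).trans_eq ?_))
  · simp only [Set.mem_ofPred_eq, lt_abs, Set.mem_union, empiricalMean, integral_neg,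
      Finset.sum_neg_distrib] at hD ⊢
    refine hD.imp_right fun hD => hD.trans_eq (by ring)
  · rw [← ENNReal.ofReal_add (Real.exp_pos _).le (Real.exp_pos _).le, two_mul]

end MeasureTheory

/-! ### The empirical losses as sample averages -/

namespace ACrab

variable {S A : Type*} [Fintype A] [MeasurableSpace S] [MeasurableSpace A]

/-- The summand `w(s, a) (f(s, a) - r - γ f(s', π))` of the empirical weighted Bellman error. -/
def bellmanSample (γ : ℝ) (w f : S × A → ℝ) (π : Policy S A) (z : Transition S A) : ℝ :=
  w z.1 * (f z.1 - z.2.1 - γ * Policy.evalAt f z.2.2 π)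

/-- The summand `f(s, π) - f(s, a)` of the empirical actor objective. -/
def actorSample (f : S × A → ℝ) (π : Policy S A) (z : Transition S A) : ℝ :=
  Policy.evalAt f z.1.1 π - f z.1

variable [MeasurableSingletonClass A] {f w : S × A → ℝ} {C B : ℝ}

theorem measurable_bellmanSample (γ : ℝ) (hw : Measurable w) (hf : Measurable f)
    (π : Policy S A) : Measurable (bellmanSample γ w f π) := by
  have := Policy.measurable_evalAt hf π
  unfold bellmanSample
  fun_prop

theorem measurable_actorSample (hf : Measurable f) (π : Policy S A) :
    Measurable (actorSample f π) := by
  have := Policy.measurable_evalAt hf π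
  unfold actorSample
  fun_prop

theorem abs_actorSample_le (hfC : ∀ x, f x ∈ Set.Icc 0 C) (π : Policy S A)
    (z : Transition S A) : |actorSample f π z| ≤ C := by
  have h1 := Policy.evalAt_mem_Icc hfC π z.1.1
  have h2 := hfC z.1
  rw [actorSample, abs_le]
  constructor <;> linarith [h1.1, h1.2, h2.1, h2.2]

theorem abs_bellmanSample_le {γ : ℝ} (hγ0 : 0 ≤ γ) (hγ1 : γ ≤ 1) (hC : 1 ≤ C)
    (hw : ∀ x, 0 ≤ w x) (hfC : ∀ x, f x ∈ Set.Icc 0 C) (π : Policy S A) {z : Transition S A}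
    (hz : z.2.1 ∈ Set.Icc (0 : ℝ) 1) : |bellmanSample γ w f π z| ≤ w z.1 * (2 * C) := by
  rw [bellmanSample, abs_mul, abs_of_nonneg (hw _)]
  refine mul_le_mul_of_nonneg_left ?_ (hw _)
  have h1 := Policy.evalAt_mem_Icc hfC π z.2.2
  have h2 := hfC z.1
  have h3 : 0 ≤ γ * Policy.evalAt f z.2.2 π := mul_nonneg hγ0 h1.1
  have h4 : γ * Policy.evalAt f z.2.2 π ≤ C := (mul_le_of_le_one_left h1.1 hγ1).trans h1.2
  rw [abs_le]
  constructor <;> linarith [h2.1, h2.2, hz.1, hz.2]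

end ACrab

namespace MDP

variable {S A : Type*} [MeasurableSpace S] [MeasurableSpace A] (M : MDP S A)
  (μ : Measure (S × A)) [IsProbabilityMeasure μ]

instance isProbabilityMeasure_transitionLaw : IsProbabilityMeasure (M.transitionLaw μ) := by
  rw [transitionLaw]
  infer_instance

theorem integral_fst_transitionLaw {g : S × A → ℝ} {C : ℝ} (hg : Measurable g)
    (hC : ∀ x, |g x| ≤ C) : ∫ z, g z.1 ∂(M.transitionLaw μ) = ∫ x, g x ∂μ := by
  rw [transitionLaw, Measure.integral_compProd
    (integrable_of_abs_le (hg.fun_comp measurable_fst) fun z => hC z.1)]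
  simp

theorem ae_reward_mem_Icc_transitionLaw :
    ∀ᵐ z ∂(M.transitionLaw μ), z.2.1 ∈ Set.Icc (0 : ℝ) 1 := by
  have hms : MeasurableSet {z : Transition S A | z.2.1 ∈ Set.Icc (0 : ℝ) 1} :=
    measurableSet_Icc.preimage (by fun_prop)
  rw [transitionLaw, Measure.ae_compProd_iff hms]
  refine ae_of_all _ fun x => ?_
  rw [Kernel.prod_apply]
  exact Measure.quasiMeasurePreserving_fst.ae (M.ae_mem_Icc_reward x)

variable [MeasurableSingletonClass A] [Fintype A] {f w : S × A → ℝ} {C B : ℝ}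

open ACrab

theorem integral_actorSample (hf : Measurable f) (hfC : ∀ x, f x ∈ Set.Icc 0 C)
    (π : Policy S A) :
    ∫ z, actorSample f π z ∂(M.transitionLaw μ) = ∫ x, (Policy.evalAt f x.1 π - f x) ∂μ := by
  have hm : Measurable fun x : S × A => Policy.evalAt f x.1 π - f x :=
    ((Policy.measurable_evalAt hf π).fun_comp measurable_fst).sub hf
  exact M.integral_fst_transitionLaw μ hm (C := C) fun x =>
    abs_actorSample_le hfC π (x, ((0 : ℝ), x.1))

theorem ae_abs_bellmanSample_le (hC : 1 ≤ C) (hw : ∀ x, 0 ≤ w x)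
    (hfC : ∀ x, f x ∈ Set.Icc 0 C) (π : Policy S A) :
    ∀ᵐ z ∂(M.transitionLaw μ), |bellmanSample M.γ w f π z| ≤ w z.1 * (2 * C) := by
  filter_upwards [M.ae_reward_mem_Icc_transitionLaw μ] with z hz using
    abs_bellmanSample_le M.γ_nonneg M.γ_lt_one.le hC hw hfC π hz

/-- The weighted Bellman sample is an unbiased estimate of the weighted Bellman residual. -/
theorem integral_bellmanSample (hC : 1 ≤ C) (hw : Measurable w) (hwB : ∀ x, w x ∈ Set.Icc 0 B)
    (hf : Measurable f) (hfC : ∀ x, f x ∈ Set.Icc 0 C) (π : Policy S A) :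
    ∫ z, bellmanSample M.γ w f π z ∂(M.transitionLaw μ) =
      ∫ x, w x * (f x - M.bellman π f x) ∂μ := by
  have hi : Integrable (bellmanSample M.γ w f π) (M.transitionLaw μ) := by
    refine Integrable.of_bound (measurable_bellmanSample M.γ hw hf π).aestronglyMeasurable
      (B * (2 * C)) ?_
    filter_upwards [M.ae_abs_bellmanSample_le μ hC (fun x => (hwB x).1) hfC π] with z hz
    exact hz.trans (mul_le_mul_of_nonneg_right (hwB _).2 (by linarith))
  rw [transitionLaw] at hi ⊢
  rw [Measure.integral_compProd hi]
  refine integral_congr_ae (ae_of_all _ fun x => ?_)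
  have hr : Integrable (fun y : ℝ × S => y.1) ((M.R x).prod (M.P x)) :=
    (M.integrable_reward x).comp_fst _
  have he : Integrable (fun s => Policy.evalAt f s π) (M.P x) :=
    integrable_of_abs_le (C := C) (Policy.measurable_evalAt hf π) fun s => by
      have := Policy.evalAt_mem_Icc hfC π s
      rw [abs_of_nonneg this.1]
      exact this.2
  have he' : Integrable (fun y : ℝ × S => M.γ * Policy.evalAt f y.2 π)
      ((M.R x).prod (M.P x)) := (he.comp_snd _).const_mul _
  have hr' : Integrable (fun y : ℝ × S => f x - y.1) ((M.R x).prod (M.P x)) :=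
    (integrable_const _).sub hr
  simp only [bellmanSample, Kernel.prod_apply, bellman]
  rw [integral_const_mul, integral_sub hr' he',
    integral_sub (integrable_const _) hr, integral_const_mul, integral_fun_fst (fun y : ℝ => y),
    integral_fun_snd (fun s => Policy.evalAt f s π)]
  simp only [integral_const, probReal_univ, one_smul, r]
  ring

theorem integral_bellmanSample_sq_le (hC : 1 ≤ C) (hw : Measurable w)
    (hwB : ∀ x, w x ∈ Set.Icc 0 B) (hfC : ∀ x, f x ∈ Set.Icc 0 C) (π : Policy S A) :
    ∫ z, bellmanSample M.γ w f π z ^ 2 ∂(M.transitionLaw μ) ≤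
      4 * C ^ 2 * l2Norm μ w ^ 2 := by
  have hsq (x : S × A) : |w x ^ 2| ≤ B ^ 2 := by
    rw [abs_pow, abs_of_nonneg (hwB x).1]
    exact pow_le_pow_left₀ (hwB x).1 (hwB x).2 2
  calc ∫ z, bellmanSample M.γ w f π z ^ 2 ∂(M.transitionLaw μ)
      ≤ ∫ z, 4 * C ^ 2 * w z.1 ^ 2 ∂(M.transitionLaw μ) := by
        refine integral_mono_of_nonneg (ae_of_all _ fun z => sq_nonneg _)
          ((integrable_of_abs_le ((hw.pow_const 2).fun_comp measurable_fst)
            fun z => hsq z.1).const_mul _) ?_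
        filter_upwards [M.ae_abs_bellmanSample_le μ hC (fun x => (hwB x).1) hfC π] with z hz
        have := pow_le_pow_left₀ (abs_nonneg _) hz 2
        rw [sq_abs] at this
        linarith
    _ = 4 * C ^ 2 * ∫ x, w x ^ 2 ∂μ := by
        rw [integral_const_mul, M.integral_fst_transitionLaw μ (hw.pow_const 2) hsq]
    _ = _ := by rw [l2Norm, Real.sq_sqrt (integral_nonneg fun x => sq_nonneg _)]

end MDP

/-! ### Suboptimality of a run on an accurate dataset -/

namespace ACrab

variable {S A : Type*} [Fintype A] [MeasurableSpace S] [MeasurableSpace A] {N : ℕ}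

theorem abs_le_bellmanError (γ : ℝ) {W : Finset (S × A → ℝ)} (D : Dataset S A N)
    (π : Policy S A) (f : S × A → ℝ) {w : S × A → ℝ} (hw : w ∈ W) :
    |empiricalMean D (bellmanSample γ w f π)| ≤ bellmanError γ W D π f :=
  le_ciSup (f := fun w : {w : S × A → ℝ // w ∈ W} =>
    |empiricalMean D (bellmanSample γ w.1 f π)|) (Set.finite_range _).bddAbove ⟨w, hw⟩

theorem bellmanError_le (γ : ℝ) {W : Finset (S × A → ℝ)} (hW : W.Nonempty) (D : Dataset S A N)
    (π : Policy S A) (f : S × A → ℝ) {c : ℝ}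
    (h : ∀ w ∈ W, |empiricalMean D (bellmanSample γ w f π)| ≤ c) :
    bellmanError γ W D π f ≤ c :=
  have : Nonempty {w : S × A → ℝ // w ∈ W} := hW.to_subtype
  ciSup_le fun w => h w.1 w.2

theorem IsRun.policy_mem [Nonempty A] {γ β : ℝ} {F W : Finset (S × A → ℝ)}
    {Pi : Finset (Policy S A)} {PO : Policy S A → (S × A → ℝ) → Dataset S A N → Policy S A}
    {K : ℕ} {D : Dataset S A N} {πs : ℕ → Policy S A} {fs : ℕ → S × A → ℝ}
    (hrun : IsRun γ β F W PO K D πs fs) (hunif : Policy.uniform S A ∈ Pi)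
    (hPO : ∀ π ∈ Pi, ∀ f ∈ F, ∀ D, PO π f D ∈ Pi) : ∀ k < K, πs k ∈ Pi := by
  intro k
  induction k with
  | zero => exact fun _ => hrun.init ▸ hunif
  | succ k ih =>
    intro hk
    rw [hrun.actor k hk]
    exact hPO _ (ih (by omega)) _ (hrun.critic_mem k (by omega)) D

/-- The dataset estimates both population losses, of every critic, policy and weight in the
classes, within `e`. -/
structure UniformlyAccurate (M : MDP S A) (μ : Measure (S × A)) (F W : Finset (S × A → ℝ))
    (Pi : Finset (Policy S A)) (e : ℝ) (D : Dataset S A N) : Prop where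
  actor : ∀ f ∈ F, ∀ π ∈ Pi,
    |empiricalMean D (actorSample f π) - ∫ x, (Policy.evalAt f x.1 π - f x) ∂μ| ≤ e
  bellman : ∀ f ∈ F, ∀ π ∈ Pi, ∀ w ∈ W,
    |empiricalMean D (bellmanSample M.γ w f π) - ∫ x, w x * (f x - M.bellman π f x) ∂μ| ≤ e

end ACrab

theorem l2Norm_one {X : Type*} [MeasurableSpace X] (μ : Measure X) [IsProbabilityMeasure μ] :
    l2Norm μ (fun _ => 1) = 1 := by
  simp [l2Norm]

theorem l2Norm_nonneg {X : Type*} [MeasurableSpace X] (μ : Measure X) (g : X → ℝ) :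
    0 ≤ l2Norm μ g := Real.sqrt_nonneg _

namespace MDP

variable {S A : Type*} [MeasurableSpace S] [MeasurableSpace A] (M : MDP S A)

theorem IsImportanceWeight.integral_eq {M : MDP S A} {μ : Measure (S × A)} {π : Policy S A}
    {w : S × A → ℝ} (h : M.IsImportanceWeight μ π w) (hw : Measurable w) (hw0 : ∀ x, 0 ≤ w x)
    (g : S × A → ℝ) : ∫ x, g x ∂(M.occupancy π) = ∫ x, w x * g x ∂μ := by
  rw [h, integral_withDensity_eq_integral_toReal_smul hw.ennreal_ofReal
    (ae_of_all _ fun _ => ENNReal.ofReal_lt_top)]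
  simp only [ENNReal.toReal_ofReal (hw0 _), smul_eq_mul]

variable [MeasurableSingletonClass A] [Fintype A] {N : ℕ} {F W : Finset (S × A → ℝ)}
  {Pi : Finset (Policy S A)} {C B Cw ε e : ℝ} {behavior π p : Policy S A}

open ACrab

theorem abs_integral_mul_residual_le {μ : Measure (S × A)} [IsProbabilityMeasure μ]
    {f w : S × A → ℝ} (hf : Measurable f) (hfC : ∀ x, f x ∈ Set.Icc 0 C) (hw : Measurable w)
    (hwB : ∀ x, w x ∈ Set.Icc 0 B) (hwC : l2Norm μ w ≤ Cw)
    (hε : l2Norm μ (fun x => f x - M.bellman p f x) ^ 2 ≤ ε) :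
    |∫ x, w x * (f x - M.bellman p f x) ∂μ| ≤ Cw * √ε :=
  (abs_integral_mul_le_l2Norm hw (hf.sub (M.measurable_bellman hf p))
    (fun x => (abs_of_nonneg (hwB x).1).trans_le (hwB x).2)
    (M.abs_sub_bellman_le hfC p)).trans
    (mul_le_mul hwC (Real.le_sqrt_of_sq_le hε) (l2Norm_nonneg _ _)
      ((l2Norm_nonneg _ _).trans hwC))

/-- One round of A-Crab on a uniformly accurate dataset. The suboptimality of `p` is split as
`(J π - Ĵ) + (Ĵ - J_b) + (J_b - Ĵ⋆) + (Ĵ⋆ - J p)`, where `Ĵ` and `Ĵ⋆` are the estimates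
`(1 - γ) E_ρ[f(s, p)]` of `J p` by the selected and by the nearly realizable critic and `J_b` is
the value of the behavior policy. -/
theorem J_sub_J_le_of_critic_min {D : Dataset S A N}
    (hF : ∀ f ∈ F, Measurable f ∧ ∀ x, f x ∈ Set.Icc 0 C)
    (hW : ∀ w ∈ W, Measurable w ∧ ∀ x, w x ∈ Set.Icc 0 B) (h1 : (fun _ => 1) ∈ W)
    (hb : behavior ∈ Pi) (hreal : M.ApproxRealizable F Pi ε)
    (hCw : ∀ w ∈ W, l2Norm (M.occupancy behavior) w ≤ Cw)
    (hπ : ∃ w ∈ W, M.IsImportanceWeight (M.occupancy behavior) π w)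
    (hD : UniformlyAccurate M (M.occupancy behavior) F W Pi e D) (hp : p ∈ Pi)
    {f : S × A → ℝ} (hf : f ∈ F)
    (hmin : ∀ g ∈ F, criticObjective M.γ 2 W D p f ≤ criticObjective M.γ 2 W D p g) :
    M.J π - M.J p ≤ 6 * e + 4 * (Cw * √ε) +
      ∫ x, (Policy.evalAt f x.1 π - Policy.evalAt f x.1 p) ∂(M.occupancy π) := by
  obtain ⟨g, hg, hgε⟩ := hreal p hp
  obtain ⟨w, hw, hwπ⟩ := hπ
  obtain ⟨hfm, hfC⟩ := hF f hf
  obtain ⟨hgm, hgC⟩ := hF g hg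
  have hCw1 : 1 ≤ Cw := (l2Norm_one (M.occupancy behavior)).symm.trans_le (hCw _ h1)
  have hf_sub_π := M.critic_value_sub_J hfm hfC p π
  have hf_sub_b := M.critic_value_sub_J hfm hfC p behavior
  have hg_sub_b := M.critic_value_sub_J hgm hgC p behavior
  have hg_sub_p := M.critic_value_sub_J hgm hgC p p
  -- Under its own occupancy, `p` has zero actor loss.
  have hloss_p : ∫ x, (Policy.evalAt g x.1 p - g x) ∂(M.occupancy p) = 0 := by
    rw [integral_sub, M.integral_evalAt_occupancy hgm hgC p, sub_self]
    · exact integrable_of_abs_le (C := C)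
        ((Policy.measurable_evalAt hgm p).fun_comp measurable_fst) fun x => by
          have := Policy.evalAt_mem_Icc hgC p x.1
          rw [abs_of_nonneg this.1]; exact this.2
    · exact integrable_of_abs_le (C := C) hgm fun x => by
        rw [abs_of_nonneg (hgC x).1]; exact (hgC x).2
  -- Under the occupancy of `π`, the actor loss of `p` is minus the regret against `π`.
  have hloss_π : ∫ x, (Policy.evalAt f x.1 π - Policy.evalAt f x.1 p) ∂(M.occupancy π) =
      -∫ x, (Policy.evalAt f x.1 p - f x) ∂(M.occupancy π) := by
    have hint (q : Policy S A) :
        Integrable (fun x : S × A => Policy.evalAt f x.1 q) (M.occupancy π) :=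
      integrable_of_abs_le (C := C)
        ((Policy.measurable_evalAt hfm q).fun_comp measurable_fst) fun x => by
          have := Policy.evalAt_mem_Icc hfC q x.1
          rw [abs_of_nonneg this.1]; exact this.2
    have hintf : Integrable f (M.occupancy π) := integrable_of_abs_le (C := C) hfm fun x => by
      rw [abs_of_nonneg (hfC x).1]; exact (hfC x).2
    rw [integral_sub (hint π) (hint p), integral_sub (hint p) hintf,
      M.integral_evalAt_occupancy hfm hfC π]
    ring
  have hres_π := hwπ.integral_eq (hW w hw).1 (fun x => ((hW w hw).2 x).1)
    fun x => f x - M.bellman p f x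
  have hres_p : |∫ x, (g x - M.bellman p g x) ∂(M.occupancy p)| ≤ √ε := by
    simpa using M.abs_integral_mul_residual_le (B := 1) hgm hgC
      (measurable_const (a := (1 : ℝ))) (by simp) (l2Norm_one _).le (hgε p hp)
  have hres_b (u : S × A → ℝ) (hu : u ∈ W) :=
    M.abs_integral_mul_residual_le hgm hgC (hW u hu).1 (hW u hu).2 (hCw u hu)
      (hgε behavior hb)
  have hres_b1 := hres_b _ h1
  -- Population residuals of `f` are controlled by its empirical Bellman error.
  have hw_f := hD.bellman f hf p hp w hw
  have h1_f := hD.bellman f hf p hp _ h1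
  have hw_err := abs_le_bellmanError M.γ D p f hw
  have h1_err := abs_le_bellmanError M.γ D p f h1
  have hg_err : bellmanError M.γ W D p g ≤ Cw * √ε + e := by
    refine bellmanError_le M.γ ⟨_, h1⟩ D p g fun u hu => ?_
    have h2 := hres_b u hu
    have h3 := hD.bellman g hg p hp u hu
    rw [abs_le] at *
    constructor <;> linarith
  have hLf := hD.actor f hf p hp
  have hLg := hD.actor g hg p hp
  have hmin' : empiricalMean D (actorSample f p) + 2 * bellmanError M.γ W D p f ≤
      empiricalMean D (actorSample g p) + 2 * bellmanError M.γ W D p g := hmin g hg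
  have hε_le : √ε ≤ Cw * √ε := le_mul_of_one_le_left (Real.sqrt_nonneg _) hCw1
  simp only [one_mul] at h1_f hres_b1
  rw [abs_le] at *
  linarith [hw_f.1, hw_f.2, h1_f.1, h1_f.2]

/-- Averaging the bound of `J_sub_J_le_of_critic_min` over the rounds of a run. -/
theorem J_sub_JMixture_le [Nonempty A] {K : ℕ} (hK : 0 < K) {D : Dataset S A N}
    {PO : Policy S A → (S × A → ℝ) → Dataset S A N → Policy S A}
    {πs : ℕ → Policy S A} {fs : ℕ → S × A → ℝ}
    (hF : ∀ f ∈ F, Measurable f ∧ ∀ x, f x ∈ Set.Icc 0 C)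
    (hW : ∀ w ∈ W, Measurable w ∧ ∀ x, w x ∈ Set.Icc 0 B) (h1 : (fun _ => 1) ∈ W)
    (hb : behavior ∈ Pi) (hreal : M.ApproxRealizable F Pi ε)
    (hCw : ∀ w ∈ W, l2Norm (M.occupancy behavior) w ≤ Cw)
    (hπ : ∃ w ∈ W, M.IsImportanceWeight (M.occupancy behavior) π w)
    (hunif : Policy.uniform S A ∈ Pi) (hPO : ∀ π ∈ Pi, ∀ f ∈ F, ∀ D, PO π f D ∈ Pi)
    (hD : UniformlyAccurate M (M.occupancy behavior) F W Pi e D)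
    (hrun : IsRun M.γ 2 F W PO K D πs fs) :
    M.J π - M.JMixture K πs ≤ 6 * e + 4 * (Cw * √ε) + M.optError π K πs fs := by
  have hK' : (0 : ℝ) < K := Nat.cast_pos.2 hK
  have hsum : ∑ k ∈ Finset.range K, (M.J π - M.J (πs k)) ≤
      ∑ k ∈ Finset.range K, (6 * e + 4 * (Cw * √ε) +
        ∫ x, (Policy.evalAt (fs k) x.1 π - Policy.evalAt (fs k) x.1 (πs k))
          ∂(M.occupancy π)) := by
    refine Finset.sum_le_sum fun k hk => ?_
    rw [Finset.mem_range] at hk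
    exact M.J_sub_J_le_of_critic_min hF hW h1 hb hreal hCw hπ hD
      (hrun.policy_mem hunif hPO k hk) (hrun.critic_mem k hk) (hrun.critic_min k hk)
  rw [Finset.sum_sub_distrib, Finset.sum_add_distrib] at hsum
  simp only [Finset.sum_const, Finset.card_range, nsmul_eq_mul] at hsum
  have hscale := mul_le_mul_of_nonneg_left hsum (one_div_pos.2 hK').le
  rw [mul_sub, mul_add, ← mul_assoc, ← mul_assoc, one_div_mul_cancel hK'.ne', one_mul,
    one_mul] at hscale
  exact hscale

/-! ### Uniform accuracy with high probability -/

/-- A union bound over two-sided deviations. For each critic and policy there are `1 + |W| ≤ 2 |W|`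
losses, the actor loss and one Bellman error per weight, which gives the factor `4`. -/
theorem measure_not_uniformlyAccurate_le {L : ℝ} (hC : 1 ≤ C) (hN : 0 < N) (hL : 0 ≤ L)
    (hF : ∀ f ∈ F, Measurable f ∧ ∀ x, f x ∈ Set.Icc 0 C)
    (hW : ∀ w ∈ W, Measurable w ∧ ∀ x, w x ∈ Set.Icc 0 B) (h1 : (fun _ => 1) ∈ W)
    {μ : Measure (S × A)} [IsProbabilityMeasure μ] (hCw : ∀ w ∈ W, l2Norm μ w ≤ Cw) :
    M.dataLaw μ N {D | ¬ UniformlyAccurate M μ F W Pi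
        (bernsteinDeviation (2 * C * B) (4 * C ^ 2 * Cw ^ 2) L N) D} ≤
      ENNReal.ofReal (4 * (F.card * Pi.card * W.card) * Real.exp (-L)) := by
  have hCw1 : 1 ≤ Cw := (l2Norm_one μ).symm.trans_le (hCw _ h1)
  have hC0 : 0 < C := by linarith
  set b := 2 * C * B
  set v := 4 * C ^ 2 * Cw ^ 2
  set e := bernsteinDeviation b v L N
  set ν := M.transitionLaw μ
  set badActor : (S × A → ℝ) × Policy S A → Set (Dataset S A N) := fun q =>
    {D | e < |empiricalMean D (actorSample q.1 q.2) - ∫ z, actorSample q.1 q.2 z ∂ν|}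
  set badBellman : (S × A → ℝ) × Policy S A → (S × A → ℝ) → Set (Dataset S A N) := fun q w =>
    {D | e < |empiricalMean D (bellmanSample M.γ w q.1 q.2) -
      ∫ z, bellmanSample M.γ w q.1 q.2 z ∂ν|}
  have hsub : {D | ¬ UniformlyAccurate M μ F W Pi e D} ⊆
      ⋃ q ∈ F ×ˢ Pi, (badActor q ∪ ⋃ w ∈ W, badBellman q w) := by
    intro D hD
    by_contra hcon
    refine hD ⟨fun f hf p hp => ?_, fun f hf p hp w hw => ?_⟩
    · rw [← M.integral_actorSample μ (hF f hf).1 (hF f hf).2 p]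
      by_contra! hlt
      exact hcon (Set.mem_biUnion (Finset.mk_mem_product hf hp) (Or.inl hlt))
    · rw [← M.integral_bellmanSample μ hC (hW w hw).1 (hW w hw).2 (hF f hf).1 (hF f hf).2 p]
      by_contra! hlt
      exact hcon (Set.mem_biUnion (Finset.mk_mem_product hf hp)
        (Or.inr (Set.mem_biUnion hw hlt)))
  have hB : 1 ≤ B := by
    obtain ⟨x⟩ := nonempty_of_isProbabilityMeasure μ
    exact ((hW _ h1).2 x).2
  have hb0 : 0 < b := by positivity
  have hv0 : 0 < v := by positivity
  have hCb : C ≤ b := by nlinarith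
  have hC2v : C ^ 2 ≤ v := by
    have : 1 ≤ Cw ^ 2 := one_le_pow₀ hCw1
    nlinarith [sq_nonneg C]
  have hactor (q : (S × A → ℝ) × Policy S A) (hq : q ∈ F ×ˢ Pi) :
      M.dataLaw μ N (badActor q) ≤ ENNReal.ofReal (2 * Real.exp (-L)) := by
    obtain ⟨hfm, hfC⟩ := hF q.1 (Finset.mem_product.1 hq).1
    have hle := abs_actorSample_le hfC q.2
    refine measure_abs_deviation_le_exp (measurable_actorSample hfm q.2)
      (ae_of_all _ fun z => (hle z).trans hCb) (le_trans ?_ hC2v) hb0 hv0 hL hN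
    refine (le_abs_self _).trans (abs_integral_le_of_abs_le fun z => ?_)
    rw [abs_pow]
    exact pow_le_pow_left₀ (abs_nonneg _) (hle z) 2
  have hbellman (q : (S × A → ℝ) × Policy S A) (hq : q ∈ F ×ˢ Pi) (w : S × A → ℝ)
      (hw : w ∈ W) : M.dataLaw μ N (badBellman q w) ≤ ENNReal.ofReal (2 * Real.exp (-L)) := by
    obtain ⟨hfm, hfC⟩ := hF q.1 (Finset.mem_product.1 hq).1
    obtain ⟨hwm, hwB⟩ := hW w hw
    refine measure_abs_deviation_le_exp (measurable_bellmanSample M.γ hwm hfm q.2) ?_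
      ((M.integral_bellmanSample_sq_le μ hC hwm hwB hfC q.2).trans ?_) hb0 hv0 hL hN
    · filter_upwards [M.ae_abs_bellmanSample_le μ hC (fun x => (hwB x).1) hfC q.2] with z hz
      refine hz.trans ?_
      rw [mul_comm]
      exact mul_le_mul_of_nonneg_left (hwB _).2 (by linarith)
    · exact mul_le_mul_of_nonneg_left (pow_le_pow_left₀ (l2Norm_nonneg _ _) (hCw w hw) 2)
        (by positivity)
  have hcW : 1 ≤ W.card := Finset.card_pos.2 ⟨_, h1⟩
  calc M.dataLaw μ N {D | ¬ UniformlyAccurate M μ F W Pi e D}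
      ≤ ∑ q ∈ F ×ˢ Pi, M.dataLaw μ N (badActor q ∪ ⋃ w ∈ W, badBellman q w) :=
        (measure_mono hsub).trans (measure_biUnion_finset_le _ _)
    _ ≤ ∑ q ∈ F ×ˢ Pi, (ENNReal.ofReal (2 * Real.exp (-L)) +
          ∑ w ∈ W, ENNReal.ofReal (2 * Real.exp (-L))) := by
        refine Finset.sum_le_sum fun q hq => (measure_union_le _ _).trans
          (add_le_add (hactor q hq) ((measure_biUnion_finset_le _ _).trans
            (Finset.sum_le_sum fun w hw => hbellman q hq w hw)))
    _ = ((F.card * Pi.card * (1 + W.card) : ℕ) : ENNReal) *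
          ENNReal.ofReal (2 * Real.exp (-L)) := by
        rw [Finset.sum_const, Finset.sum_const, Finset.card_product, nsmul_eq_mul, nsmul_eq_mul]
        push_cast
        ring
    _ ≤ ((2 * (F.card * Pi.card * W.card) : ℕ) : ENNReal) *
          ENNReal.ofReal (2 * Real.exp (-L)) := by
        have hcard : F.card * Pi.card * (1 + W.card) ≤ 2 * (F.card * Pi.card * W.card) :=
          calc F.card * Pi.card * (1 + W.card) ≤ F.card * Pi.card * (W.card + W.card) :=
                Nat.mul_le_mul_left _ (by omega)
            _ = 2 * (F.card * Pi.card * W.card) := by ring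
        exact mul_le_mul' (Nat.cast_le.2 hcard) le_rfl
    _ = ENNReal.ofReal (4 * (F.card * Pi.card * W.card) * Real.exp (-L)) := by
        rw [← ENNReal.ofReal_natCast, ← ENNReal.ofReal_mul (Nat.cast_nonneg _)]
        congr 1
        push_cast
        ring

end MDP

theorem bernsteinDeviation_le_epsStat {C B Cw δ L : ℝ} {cF cPi cW N : ℕ} (hC : 0 ≤ C)
    (hCw : 0 ≤ Cw) (hB : 0 ≤ B) (hℓ : 0 ≤ Real.log ((cF : ℝ) * cPi * cW / δ))
    (hL : L ≤ 3 * Real.log ((cF : ℝ) * cPi * cW / δ)) :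
    bernsteinDeviation (2 * C * B) (4 * C ^ 2 * Cw ^ 2) L N ≤ 7 * epsStat C Cw B δ cF cPi cW N := by
  rw [bernsteinDeviation, epsStat]
  set ℓ := Real.log ((cF : ℝ) * cPi * cW / δ)
  have h1 : √(4 * C ^ 2 * Cw ^ 2 * L / N) ≤ 7 / 2 * (C * Cw * √(ℓ / N)) := by
    refine Real.sqrt_le_iff.2 ⟨by positivity, ?_⟩
    have hsq : √(ℓ / N) ^ 2 = ℓ / N := Real.sq_sqrt (by positivity)
    calc 4 * C ^ 2 * Cw ^ 2 * L / N ≤ 4 * C ^ 2 * Cw ^ 2 * (3 * ℓ) / N := by gcongr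
      _ = 12 * (C ^ 2 * Cw ^ 2 * (ℓ / N)) := by ring
      _ ≤ 49 / 4 * (C ^ 2 * Cw ^ 2 * (ℓ / N)) := by
        have : 0 ≤ C ^ 2 * Cw ^ 2 * (ℓ / N) := by positivity
        linarith
      _ = (7 / 2 * (C * Cw * √(ℓ / N))) ^ 2 := by rw [mul_pow, mul_pow, mul_pow, hsq]; ring
  have h2 : 2 * C * B * L / N ≤ 7 * (C * B * ℓ / N) :=
    calc 2 * C * B * L / N ≤ 2 * C * B * (3 * ℓ) / N := by gcongr
      _ = 6 * (C * B * ℓ / N) := by ring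
      _ ≤ 7 * (C * B * ℓ / N) := by
        have : 0 ≤ C * B * ℓ / N := by positivity
        linarith
  linarith

end

/-! ### The suboptimality bound for A-Crab -/

theorem theorem1 :
    ∃ c : ℝ, 0 < c ∧
      ∀ (S : Type*) (A : Type*) [MeasurableSpace S] [MeasurableSpace A]
        [MeasurableSingletonClass A] [Fintype A] [Nonempty A]
        (M : MDP S A)
        (F W : Finset (S × A → ℝ)) (Pi : Finset (Policy S A))
        (Vmax Bw Cstar εF δ : ℝ) (N K : ℕ) (behavior π : Policy S A)
        (PO : Policy S A → (S × A → ℝ) → Dataset S A N → Policy S A),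
        -- the function classes
        1 ≤ Vmax →
        (∀ f ∈ F, Measurable f ∧ ∀ x, f x ∈ Set.Icc 0 Vmax) →
        (∀ w ∈ W, Measurable w ∧ ∀ x, w x ∈ Set.Icc 0 Bw) →
        (fun _ => 1) ∈ W →
        -- the data distribution is the occupancy of a behavior policy in the class
        behavior ∈ Pi →
        -- approximate realizability
        0 ≤ εF →
        M.ApproxRealizable F Pi εF →
        -- bound on the weighted norm of the weight class
        (∀ w ∈ W, l2Norm (M.occupancy behavior) w ≤ Cstar) →
        -- the comparator policy and the realizability of its importance weight
        π ∈ Pi →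
        (∃ w ∈ W, M.IsImportanceWeight (M.occupancy behavior) π w) →
        -- the algorithm selects its policies from the policy class
        Policy.uniform S A ∈ Pi →
        (∀ π' ∈ Pi, ∀ f ∈ F, ∀ D, PO π' f D ∈ Pi) →
        0 < N → 0 < K → 0 < δ → δ < 1 →
        -- with probability at least `1 - δ` over the dataset, the bound holds for every run
        M.dataLaw (M.occupancy behavior) N
          {D | ¬ ∀ (πs : ℕ → Policy S A) (fs : ℕ → S × A → ℝ),
            ACrab.IsRun M.γ 2 F W PO K D πs fs →
            M.J π - M.JMixture K πs ≤
              c * (epsStat Vmax Cstar Bw δ F.card Pi.card W.card N + Cstar * √εF)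
                + M.optError π K πs fs}
          ≤ ENNReal.ofReal δ := by
  refine ⟨42, by norm_num, ?_⟩
  intro S A _ _ _ _ _ M F W Pi Vmax Bw Cstar εF δ N K behavior π PO hV hF hW h1 hb hε hreal hCw
    hπ hwπ hunif hPO hN hK hδ0 hδ1
  obtain ⟨f₀, hf₀, -⟩ := hreal π hπ
  have hcF : 1 ≤ F.card := Finset.card_pos.2 ⟨f₀, hf₀⟩
  have hcW : 1 ≤ W.card := Finset.card_pos.2 ⟨_, h1⟩
  have hcPi : 1 ≤ Pi.card := Finset.card_pos.2 ⟨π, hπ⟩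
  have hCstar : 1 ≤ Cstar := (l2Norm_one (M.occupancy behavior)).symm.trans_le (hCw _ h1)
  have hBw : 1 ≤ Bw := by
    obtain ⟨x⟩ := nonempty_of_isProbabilityMeasure (M.occupancy behavior)
    exact ((hW _ h1).2 x).2
  set n : ℝ := (F.card : ℝ) * Pi.card * W.card with hn
  have hn_nat : n = ((F.card * Pi.card * W.card : ℕ) : ℝ) := by push_cast; rfl
  have hn1 : 1 ≤ n := by
    rw [hn_nat]
    exact_mod_cast Nat.mul_pos (Nat.mul_pos hcF hcPi) hcW
  have hnδ : n ≤ n / δ := le_div_self (by linarith) hδ0 hδ1.le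
  have hℓ : 0 ≤ Real.log (n / δ) := Real.log_nonneg (hn1.trans hnδ)
  rcases hcPi.eq_or_lt with hPi | hPi
  · -- With a single policy in the class nothing is lost. This case has to be treated apart:
    -- `log (n / δ)` may then be arbitrarily small and cannot absorb the constant `4` below.
    refine le_of_eq_of_le (measure_mono_null (t := ∅) ?_ measure_empty) zero_le
    intro D hD
    refine hD fun πs fs hrun => ?_
    obtain ⟨p, hp⟩ := Finset.card_eq_one.1 hPi.symm
    have hπp : π = p := Finset.mem_singleton.1 (hp ▸ hπ)
    have hπs (k : ℕ) (hk : k ∈ Finset.range K) : πs k = π := by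
      rw [hπp]
      exact Finset.mem_singleton.1
        (hp ▸ hrun.policy_mem hunif hPO k (Finset.mem_range.1 hk))
    have hJ : M.JMixture K πs = M.J π := by
      have hK' : (K : ℝ) ≠ 0 := by positivity
      rw [MDP.JMixture, Finset.sum_congr rfl fun k hk => by rw [hπs k hk]]
      simp [hK']
    have hopt : M.optError π K πs fs = 0 := by
      rw [MDP.optError, Finset.sum_eq_zero fun k hk => by rw [hπs k hk]; simp, mul_zero]
    rw [hJ, hopt, sub_self, add_zero, epsStat]
    positivity
  · set L := Real.log (4 * n / δ) with hL
    have hn2 : 2 ≤ n := by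
      rw [hn_nat]
      exact_mod_cast (Nat.mul_le_mul (Nat.mul_le_mul hcF hPi) hcW)
    have hL0 : 0 ≤ L := Real.log_nonneg (by rw [mul_div_assoc]; linarith)
    have hL3 : L ≤ 3 * Real.log (n / δ) := by
      have h4 : Real.log 4 ≤ 2 * Real.log (n / δ) := by
        rw [show (4 : ℝ) = 2 ^ 2 by norm_num, Real.log_pow, Nat.cast_ofNat]
        exact mul_le_mul_of_nonneg_left (Real.log_le_log (by norm_num) (hn2.trans hnδ))
          (by norm_num)
      rw [hL, mul_div_assoc, Real.log_mul (by norm_num) (by positivity)]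
      linarith
    have hdev := bernsteinDeviation_le_epsStat (N := N) (L := L) (C := Vmax) (B := Bw)
      (Cw := Cstar) (by linarith) (by linarith) (by linarith) hℓ hL3
    have hfail := M.measure_not_uniformlyAccurate_le (Pi := Pi) hV hN hL0 hF hW h1 hCw
    have hδ : 4 * ((F.card : ℝ) * Pi.card * W.card) * Real.exp (-L) = δ := by
      rw [← hn, hL, Real.exp_neg, Real.exp_log (by positivity)]
      field_simp
    rw [hδ] at hfail
    refine le_trans (measure_mono ?_) hfail
    intro D hD hacc
    refine hD fun πs fs hrun => ?_
    have := M.J_sub_JMixture_le hK hF hW h1 hb hreal hCw hwπ hunif hPO hacc hrun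
    have : 0 ≤ Cstar * √εF := by positivity
    linarith
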